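/- For complex numbers $a,q$ with $|q|<1$ put $(a)_\infty=(a;q)_\infty:=\prod_{j\ge 0}(1-aq^j)$. Let $\ell\ge 3$ be an integer. For every complex $q$ with $0<|q|<1$, the function $$\zeta\mapsto \frac{(q)_\infty}{(\zeta)_\infty^{\ell}\,(\zeta^{-1}q)_\infty^{\ell}}$$ has a unique Laurent expansion $\sum_{n\in\mathbb Z}a_n\zeta^n$ on the annulus $|q|<|\zeta|<1$. For $s\in\mathbb N_0$ let $\operatorname{coeff}_{\zeta^s}$ denote the coefficient of $\zeta^s$ in this expansion, and define $$F_{\ell,s}(q):=(q)_\infty^{\ell^2-1}\,\operatorname{coeff}_{\zeta^s}\frac{(q)_\infty}{(\zeta)_\infty^{\ell}\,(\zeta^{-1}q)_\infty^{\ell}} .$$ Then for every $s\in\mathbb N_0$, as $t\to 0^+$ (with $t$ real), $$F_{\ell,s}\left(e^{-t}\right)\sim \mathcal C_\ell\left(\frac{t}{2\pi}\right)^{1-\frac{\ell^2}{2}}e^{-\frac{\pi^2(\ell^2-2\ell)}{6t}},\qquad \mathcal C_\ell:=\frac{2^{1-2\ell}(\ell-1)!}{\Gamma\left(\frac{\ell+1}{2}\right)^2},$$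 that is, the quotient of the two sides tends to $1$. In particular the leading asymptotic term does not depend on $s$. -/

import Mathlib

open Filter Topology Asymptotics

/-- The infinite `q`-Pochhammer symbol `(a; q)_∞ = ∏_{j ≥ 0} (1 - a q ^ j)`
(convergent for `‖q‖ < 1`). -/
noncomputable def qPochInf (a q : ℂ) : ℂ := ∏' j : ℕ, (1 - a * q ^ j)

/-- `∑_{n ∈ ℤ} a n ζ ^ n` is a Laurent expansion of `f` on the open annulus `r < ‖ζ‖ < R`. -/
def IsLaurentExpansionOn (f : ℂ → ℂ) (a : ℤ → ℂ) (r R : ℝ) : Prop :=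
  ∀ ζ : ℂ, r < ‖ζ‖ → ‖ζ‖ < R → HasSum (fun n : ℤ => a n * ζ ^ n) (f ζ)

open Classical in
/-- The coefficient of `ζ ^ n` in the Laurent expansion of `f` on the annulus `r < ‖ζ‖ < R`
(`0` by convention if there is no such expansion). -/
noncomputable def laurentCoeff (f : ℂ → ℂ) (r R : ℝ) (n : ℤ) : ℂ :=
  if h : ∃ a : ℤ → ℂ, IsLaurentExpansionOn f a r R then h.choose n else 0

/-- The function `(q)_∞ / ((ζ)_∞ ^ ℓ (ζ⁻¹ q)_∞ ^ ℓ)` of `ζ`. -/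
noncomputable def charGen (ℓ : ℕ) (q ζ : ℂ) : ℂ :=
  qPochInf q q / (qPochInf ζ q ^ ℓ * qPochInf (ζ⁻¹ * q) q ^ ℓ)

/-- `F_{ℓ,s}(q)`: `(q)_∞ ^ (ℓ² - 1)` times the coefficient of `ζ ^ s` of `charGen ℓ q`,
expanded in the annulus `‖q‖ < ‖ζ‖ < 1`. The exponent is used for `1 ≤ ℓ` only. -/
noncomputable def charF (ℓ s : ℕ) (q : ℂ) : ℂ :=
  qPochInf q q ^ (ℓ ^ 2 - 1) * laurentCoeff (charGen ℓ q) ‖q‖ 1 (s : ℤ)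

/-- The constant `C_ℓ = 2 ^ (1 - 2ℓ) (ℓ - 1)! / Γ((ℓ + 1) / 2) ^ 2`. -/
noncomputable def charConst (ℓ : ℕ) : ℝ :=
  (2 : ℝ) ^ (1 - 2 * (ℓ : ℤ)) * ((ℓ - 1).factorial : ℝ) / Real.Gamma (((ℓ : ℝ) + 1) / 2) ^ 2

/-! The coefficient is a Cauchy integral over the circle `|ζ| = |q|^(1/2)`, the centre of the
annulus. Multiplying and dividing by `(q)_∞^ℓ` turns the denominator into the `ℓ`-th power of the
triple product `(ζ)_∞ (q/ζ)_∞ (q)_∞`, a Jacobi theta function, so everything is controlled by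
modular transformations as `q = e^(-t) → 1`.

With `ζ = e^(-t/2) e^(itu)`, the inversion `τ ↦ -1/τ` turns the triple product into `(t/2π)^(-1/2)
e^(-π²/(2t) - tu²/2)` times a series of positive terms tending to `2 cosh(πu)`
(`triple_product_eq_thetaDual`, `tendsto_thetaDual`). Likewise `(q)_∞` is asymptotic to
`(t/2π)^(-1/2) e^(-π²/(6t))` (`qPochInf_exp_neg`). There are `ℓ² + ℓ` factors `(q)_∞` and `-ℓ`
triple products, and `dθ/2π = (t/2π) du`; collecting powers gives `(t/2π)^(1-ℓ²/2)
e^(-π²(ℓ²-2ℓ)/(6t))`.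

What remains is an integral over `|u| ≤ π/t`, which tends by dominated convergence to `∫ (2 cosh
πu)^(-ℓ) du = C_ℓ`. The index `s` enters only through `e^(st/2) e^(-istu)`, which tends to `1`
pointwise and has harmless modulus; hence the limit is independent of `s`. -/

section Pochhammer

/-! ### Convergence, non-vanishing and holomorphy of the `q`-Pochhammer symbol. -/

variable {q : ℂ}

theorem summable_norm_mul_pow (hq : ‖q‖ < 1) (a : ℂ) : Summable fun j : ℕ => ‖-(a * q ^ j)‖ := by
  simpa using (summable_geometric_of_lt_one (norm_nonneg q) hq).mul_left ‖a‖

theorem multipliable_one_sub_mul_pow (hq : ‖q‖ < 1) (a : ℂ) :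
    Multipliable fun j : ℕ => 1 - a * q ^ j := by
  simpa [sub_eq_add_neg] using multipliable_one_add_of_summable (summable_norm_mul_pow hq a)

theorem tendsto_prod_qPochInf (hq : ‖q‖ < 1) (a : ℂ) :
    Tendsto (fun n : ℕ => ∏ j ∈ Finset.range n, (1 - a * q ^ j)) atTop (𝓝 (qPochInf a q)) :=
  (multipliable_one_sub_mul_pow hq a).hasProd.tendsto_prod_nat

theorem one_sub_ne_zero_of_norm_lt_one {z : ℂ} (hz : ‖z‖ < 1) : 1 - z ≠ 0 := by
  intro h
  rw [← sub_eq_zero.mp h] at hz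
  simp at hz

theorem qPochInf_ne_zero (hq : ‖q‖ < 1) {a : ℂ} (ha : ‖a‖ < 1) : qPochInf a q ≠ 0 := by
  have key : ∏' j : ℕ, (1 + -(a * q ^ j)) ≠ 0 := by
    refine tprod_one_add_ne_zero_of_summable (fun j => ?_) (summable_norm_mul_pow hq a)
    rw [← sub_eq_add_neg]
    apply one_sub_ne_zero_of_norm_lt_one
    rw [norm_mul, norm_pow]
    exact mul_lt_one_of_nonneg_of_lt_one_left (norm_nonneg _) ha
      (pow_le_one₀ (norm_nonneg _) hq.le)
  simpa [qPochInf, sub_eq_add_neg] using key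

theorem differentiableOn_qPochInf (hq : ‖q‖ < 1) :
    DifferentiableOn ℂ (fun a => qPochInf a q) (Metric.ball 0 1) := by
  have h : HasProdLocallyUniformlyOn (fun (j : ℕ) (a : ℂ) => 1 + -(a * q ^ j))
      (fun a => ∏' j : ℕ, (1 + -(a * q ^ j))) (Metric.ball 0 1) := by
    refine Summable.hasProdLocallyUniformlyOn_nat_one_add Metric.isOpen_ball
      (summable_geometric_of_lt_one (norm_nonneg q) hq) (.of_forall fun j a ha => ?_)
      (fun j => by fun_prop)
    have : ‖a‖ < 1 := by simpa using ha
    rw [norm_neg, norm_mul, norm_pow]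
    exact mul_le_of_le_one_left (by positivity) this.le
  have h2 := h.differentiableOn
    (.of_forall fun s => by
      simpa [Finset.prod_fn] using DifferentiableOn.finsetProd (fun _ _ => by fun_prop))
    Metric.isOpen_ball
  simpa [qPochInf, sub_eq_add_neg] using h2

/-! ### The Jacobi triple product, as a limit of its finite form. -/

/-- The reciprocal of `(q; q)_m`, extended by zero to negative `m`. -/
noncomputable def qPochRecip (q : ℂ) (m : ℤ) : ℂ :=
  if m < 0 then 0 else (∏ j ∈ Finset.range m.toNat, (1 - q * q ^ j))⁻¹

theorem qPochRecip_natCast (q : ℂ) (n : ℕ) :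
    qPochRecip q n = (∏ j ∈ Finset.range n, (1 - q * q ^ j))⁻¹ := by
  simp [qPochRecip]

theorem one_sub_mul_pow_ne_zero (hq : ‖q‖ < 1) (j : ℕ) : 1 - q * q ^ j ≠ 0 := by
  apply one_sub_ne_zero_of_norm_lt_one
  rw [← pow_succ', norm_pow]
  exact pow_lt_one₀ (norm_nonneg _) hq (by simp)

/-- Extension by zero makes the recurrence valid for every integer: at `m = 0` the factor `1 - q^0`
vanishes. No boundary cases are then needed in the finite triple product. -/
theorem qPochRecip_sub_one (hq : ‖q‖ < 1) (m : ℤ) :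
    qPochRecip q (m - 1) = (1 - q ^ m) * qPochRecip q m := by
  rcases lt_trichotomy m 0 with h | rfl | h
  · simp [qPochRecip, h, show m - 1 < 0 by omega]
  · simp [qPochRecip]
  · obtain ⟨n, rfl⟩ : ∃ n : ℕ, m = n + 1 := ⟨(m - 1).toNat, by omega⟩
    rw [add_sub_cancel_right, qPochRecip_natCast,
      show ((n : ℤ) + 1) = ((n + 1 : ℕ) : ℤ) by push_cast; ring, qPochRecip_natCast,
      Finset.prod_range_succ, zpow_natCast, pow_succ' q n, mul_inv]
    field_simp [one_sub_mul_pow_ne_zero hq n]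

theorem tendsto_qPochRecip (hq : ‖q‖ < 1) :
    Tendsto (fun n : ℕ => qPochRecip q n) atTop (𝓝 (qPochInf q q)⁻¹) := by
  simp_rw [qPochRecip_natCast]
  exact (tendsto_prod_qPochInf hq q).inv₀ (qPochInf_ne_zero hq hq)

theorem exists_norm_qPochRecip_le (hq : ‖q‖ < 1) : ∃ C : ℝ, 0 ≤ C ∧ ∀ m, ‖qPochRecip q m‖ ≤ C := by
  obtain ⟨C, hC⟩ := (Metric.isBounded_range_of_tendsto _ (tendsto_qPochRecip hq)).exists_norm_le
  refine ⟨max C 0, le_max_right _ _, fun m => ?_⟩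
  rcases lt_or_ge m 0 with h | h
  · simp [qPochRecip, h]
  · obtain ⟨n, rfl⟩ := Int.eq_ofNat_of_zero_le h
    exact (hC _ ⟨n, rfl⟩).trans (le_max_left _ _)

/-- The coefficient `(-1) ^ j q ^ (j (j - 1) / 2)` of the theta series. -/
noncomputable def thetaCoeff (q : ℂ) (j : ℤ) : ℂ := (-1) ^ j * q ^ (j * (j - 1) / 2)

theorem thetaCoeff_add_one (hq0 : q ≠ 0) (j : ℤ) :
    thetaCoeff q (j + 1) = -q ^ j * thetaCoeff q j := by
  have : (j + 1) * (j + 1 - 1) / 2 = j * (j - 1) / 2 + j := by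
    rw [show (j + 1) * (j + 1 - 1) = j * (j - 1) + j * 2 by ring,
      Int.add_mul_ediv_right _ _ two_ne_zero]
  rw [thetaCoeff, thetaCoeff, this, zpow_add₀ hq0, zpow_add₀ (by norm_num)]
  simp; ring

/-- The finite form of the Jacobi triple product identity. -/
theorem hasSum_finite_triple_product (hq0 : q ≠ 0) (hq : ‖q‖ < 1) {ζ : ℂ} (hζ : ζ ≠ 0) (N : ℕ) :
    HasSum (fun j : ℤ => thetaCoeff q j * ζ ^ j *
      ((∏ j ∈ Finset.range (2 * N), (1 - q * q ^ j)) * qPochRecip q (N - j) * qPochRecip q (N + j)))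
      ((∏ j ∈ Finset.range N, (1 - ζ * q ^ j)) * ∏ j ∈ Finset.range N, (1 - ζ⁻¹ * q * q ^ j)) := by
  induction N with
  | zero =>
    convert hasSum_single (0 : ℤ) _ using 1
    · simp [qPochRecip, thetaCoeff]
    · intro j hj
      rcases lt_or_gt_of_ne hj with h | h <;> simp [qPochRecip, h]
  | succ N ih =>
    -- The new factor is `(1 - ζq^N)(1 - ζ⁻¹q^(N+1)) = (1 + q^(2N+1)) - ζq^N - ζ⁻¹q^(N+1)`. Shifting
    -- the index in the last two series realigns the powers of `ζ`, so coefficients can be compared.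
    have h1 := ih.mul_left (1 + q ^ (2 * N + 1))
    have h2 := ((Equiv.addRight (-1 : ℤ)).hasSum_iff.mpr ih).mul_left (-(ζ * q ^ N))
    have h3 := ((Equiv.addRight (1 : ℤ)).hasSum_iff.mpr ih).mul_left (-(ζ⁻¹ * q ^ (N + 1)))
    convert (h1.add h2).add h3 using 1
    · rfl
    · funext j
      simp only [Function.comp_apply, Equiv.coe_addRight]
      -- Every reciprocal is reduced to those at `N + 1 - j` and `N + 1 + j`, and every theta
      -- coefficient to the one at `j - 1`; a rational identity in powers of `q` is left.
      have e1 := qPochRecip_sub_one hq ((N : ℤ) + 1 - j)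
      have e2 := qPochRecip_sub_one hq ((N : ℤ) + 1 + j)
      have e3 := qPochRecip_sub_one hq ((N : ℤ) - j)
      have e4 := qPochRecip_sub_one hq ((N : ℤ) + j)
      rw [show (N : ℤ) + 1 - j - 1 = N - j by ring] at e1
      rw [show (N : ℤ) + 1 + j - 1 = N + j by ring] at e2
      have t1 := thetaCoeff_add_one hq0 j
      have t2 := thetaCoeff_add_one hq0 (j + -1)
      rw [neg_add_cancel_right] at t2
      rw [t1, show (N : ℤ) - (j + -1) = N + 1 - j by ring, show (N : ℤ) + (j + -1) = N + j - 1 by ring,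
        show (N : ℤ) - (j + 1) = N - j - 1 by ring, show (N : ℤ) + (j + 1) = N + 1 + j by ring,
        e3, e4, e1, e2, t2, Nat.cast_succ, mul_add_one, Finset.prod_range_succ,
        Finset.prod_range_succ]
      have hj : q ^ j ≠ 0 := zpow_ne_zero _ hq0
      simp only [zpow_add₀ hq0, zpow_sub₀ hq0, zpow_add₀ hζ, zpow_natCast, zpow_one, zpow_neg,
        pow_add, pow_mul', pow_one]
      field_simp
      ring
    · rw [Finset.prod_range_succ, Finset.prod_range_succ]
      field_simp
      ring

theorem norm_exp_two_pi_mul_I_lt_one {τ : ℂ} (hτ : 0 < τ.im) :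
    ‖Complex.exp (2 * Real.pi * Complex.I * τ)‖ < 1 := by
  rw [Complex.norm_exp, Real.exp_lt_one_iff]
  have : (2 * Real.pi * Complex.I * τ).re = -(2 * Real.pi * τ.im) := by simp
  rw [this]
  have := Real.pi_pos
  simp only [Left.neg_neg_iff]
  positivity

/-- The sign `(-1)^j` is the shift of `z` by `1/2`, and the linear part of `j(j-1)/2` is the shift
by `-τ/2`. -/
theorem thetaCoeff_mul_zpow_eq_jacobiTheta₂_term (z τ : ℂ) (j : ℤ) :
    thetaCoeff (Complex.exp (2 * Real.pi * Complex.I * τ)) j *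
      Complex.exp (2 * Real.pi * Complex.I * z) ^ j =
      jacobiTheta₂_term j (z + 1 / 2 - τ / 2) τ := by
  have h2 : (2 : ℂ) * ((j * (j - 1) / 2 : ℤ) : ℂ) = j * (j - 1) := by
    have : 2 * (j * (j - 1) / 2) = j * (j - 1) :=
      Int.mul_ediv_cancel' (Int.even_mul_pred_self j).two_dvd
    exact_mod_cast this
  rw [thetaCoeff, jacobiTheta₂_term, ← Complex.exp_pi_mul_I, ← Complex.exp_int_mul,
    ← Complex.exp_int_mul, ← Complex.exp_int_mul, ← Complex.exp_add, ← Complex.exp_add]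
  congr 1
  linear_combination (Real.pi * Complex.I * τ) * h2

/-- The Jacobi triple product identity. -/
theorem jacobi_triple_product (z : ℂ) {τ : ℂ} (hτ : 0 < τ.im) {q ζ : ℂ}
    (hq : q = Complex.exp (2 * Real.pi * Complex.I * τ))
    (hζ : ζ = Complex.exp (2 * Real.pi * Complex.I * z)) :
    qPochInf ζ q * qPochInf (ζ⁻¹ * q) q * qPochInf q q = jacobiTheta₂ (z + 1 / 2 - τ / 2) τ := by
  have hq1 : ‖q‖ < 1 := hq ▸ norm_exp_two_pi_mul_I_lt_one hτ
  have hq0 : q ≠ 0 := hq ▸ Complex.exp_ne_zero _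
  have hζ0 : ζ ≠ 0 := hζ ▸ Complex.exp_ne_zero _
  have hterm (j : ℤ) : thetaCoeff q j * ζ ^ j = jacobiTheta₂_term j (z + 1 / 2 - τ / 2) τ := by
    rw [hq, hζ, thetaCoeff_mul_zpow_eq_jacobiTheta₂_term]
  obtain ⟨C, hC0, hC⟩ := exists_norm_qPochRecip_le hq1
  obtain ⟨D, hD⟩ :=
    (Metric.isBounded_range_of_tendsto _ (tendsto_prod_qPochInf hq1 q)).exists_norm_le
  have hD0 : 0 ≤ D := (norm_nonneg _).trans (hD _ ⟨0, rfl⟩)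
  have hne := qPochInf_ne_zero hq1 hq1
  have htwo : Tendsto (fun N : ℕ => 2 * N) atTop atTop :=
    tendsto_id.const_mul_atTop' two_pos
  have hshift (j : ℤ) : Tendsto (fun N : ℕ => qPochRecip q (N + j)) atTop (𝓝 (qPochInf q q)⁻¹) := by
    have h1 : Tendsto (fun N : ℕ => ((N : ℤ) + j).toNat) atTop atTop := by
      refine tendsto_atTop.mpr fun b => ?_
      filter_upwards [eventually_ge_atTop (b + j.natAbs)] with N hN
      omega
    refine ((tendsto_qPochRecip hq1).comp h1).congr' ?_
    filter_upwards [eventually_ge_atTop j.natAbs] with N hN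
    simp only [Function.comp_apply]
    congr 1
    omega
  -- Tannery's theorem: for fixed `j` the ratio `(q)_{2N} / ((q)_{N-j} (q)_{N+j})` tends to
  -- `1/(q)_∞` and is bounded uniformly in `N` and `j`, so the theta series dominates.
  have hlim : Tendsto (fun N : ℕ => ∑' j : ℤ, thetaCoeff q j * ζ ^ j *
      ((∏ j ∈ Finset.range (2 * N), (1 - q * q ^ j)) * qPochRecip q (N - j) *
        qPochRecip q (N + j))) atTop
      (𝓝 (∑' j : ℤ, thetaCoeff q j * ζ ^ j *
        (qPochInf q q * (qPochInf q q)⁻¹ * (qPochInf q q)⁻¹))) := by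
    refine tendsto_tsum_of_dominated_convergence
      (bound := fun j : ℤ => ‖jacobiTheta₂_term j (z + 1 / 2 - τ / 2) τ‖ * (D * C * C))
      (((summable_jacobiTheta₂_term_iff _ τ).mpr hτ).norm.mul_right _) (fun j => ?_)
      (.of_forall fun N j => ?_)
    · refine Tendsto.const_mul _ ((((tendsto_prod_qPochInf hq1 q).comp htwo).mul ?_).mul (hshift j))
      simpa [sub_eq_add_neg] using hshift (-j)
    · rw [norm_mul, hterm, norm_mul, norm_mul]
      gcongr
      · exact hD _ ⟨2 * N, rfl⟩
      · exact hC _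
      · exact hC _
  simp_rw [fun N => (hasSum_finite_triple_product hq0 hq1 hζ0 N).tsum_eq, mul_inv_cancel₀ hne,
    one_mul, tsum_mul_right, hterm] at hlim
  have := tendsto_nhds_unique hlim
    ((tendsto_prod_qPochInf hq1 ζ).mul (tendsto_prod_qPochInf hq1 (ζ⁻¹ * q)))
  rw [← this, jacobiTheta₂, mul_assoc, inv_mul_cancel₀ hne, mul_one]

end Pochhammer

/-! ### Laurent expansions: existence, uniqueness and Cauchy's formula. -/

section Laurent

open Complex MeasureTheory intervalIntegral

theorem integral_exp_int_mul_I (n : ℤ) :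
    ∫ θ in (-Real.pi)..Real.pi, Complex.exp (n * (θ * I)) = if n = 0 then (2 * Real.pi : ℂ) else 0 := by
  split_ifs with h
  · subst h
    simp
    ring
  · have hn : (n * I : ℂ) ≠ 0 := mul_ne_zero (by exact_mod_cast h) I_ne_zero
    have e : ∀ θ : ℝ, (n * (θ * I) : ℂ) = n * I * θ := fun θ => by ring
    simp_rw [e]
    rw [integral_exp_mul_complex hn]
    have : Complex.exp (n * I * (Real.pi : ℝ)) = Complex.exp (n * I * ((-Real.pi : ℝ) : ℂ)) := by
      rw [Complex.exp_eq_exp_iff_exists_int]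
      exact ⟨n, by push_cast; ring⟩
    rw [this, sub_self, zero_div]

/-- The coefficients of a Laurent expansion are given by Cauchy's formula on any circle inside the
annulus. -/
theorem IsLaurentExpansionOn.coeff_eq {f : ℂ → ℂ} {a : ℤ → ℂ} {r R ρ : ℝ}
    (h : IsLaurentExpansionOn f a r R) (hρ : 0 < ρ) (hr : r < ρ) (hR : ρ < R) (n : ℤ) :
    a n = (2 * Real.pi : ℂ)⁻¹ * ∫ θ in (-Real.pi)..Real.pi,
      f (ρ * exp (θ * I)) * (ρ * exp (θ * I)) ^ (-n) := by
  have hρ' : (ρ : ℂ) ≠ 0 := by exact_mod_cast hρ.ne'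
  have hz (θ : ℝ) : (ρ * exp (θ * I) : ℂ) ≠ 0 := mul_ne_zero hρ' (exp_ne_zero _)
  have hnorm (θ : ℝ) : ‖(ρ * exp (θ * I) : ℂ)‖ = ρ := by
    rw [norm_mul, norm_exp_ofReal_mul_I, mul_one, norm_real, Real.norm_of_nonneg hρ.le]
  have hsum (θ : ℝ) := h (ρ * exp (θ * I)) (by rwa [hnorm]) (by rwa [hnorm])
  -- Summability in `ℂ` is absolute, and the norms of the terms are constant on the circle, so
  -- convergence at `θ = 0` dominates the series for all `θ`.
  have hS : Summable fun m : ℤ => ‖a m‖ * ρ ^ (m - n) := by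
    have := (hsum 0).summable.norm.mul_right (ρ ^ (-n))
    refine this.congr fun m => ?_
    rw [norm_mul, norm_zpow, hnorm, mul_assoc, ← zpow_add₀ hρ.ne', sub_eq_add_neg]
  have hterm (m : ℤ) (θ : ℝ) : a m * (ρ * exp (θ * I)) ^ m * (ρ * exp (θ * I)) ^ (-n) =
      a m * ρ ^ (m - n) * exp ((m - n : ℤ) * (θ * I)) := by
    rw [mul_assoc, ← zpow_add₀ (hz θ), mul_zpow, ← exp_int_mul, ← sub_eq_add_neg, mul_assoc]
  have key : HasSum (fun m : ℤ => ∫ θ in (-Real.pi)..Real.pi,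
      a m * ρ ^ (m - n) * exp ((m - n : ℤ) * (θ * I)))
      (∫ θ in (-Real.pi)..Real.pi, f (ρ * exp (θ * I)) * (ρ * exp (θ * I)) ^ (-n)) := by
    refine hasSum_integral_of_dominated_convergence (fun m _ => ‖a m‖ * ρ ^ (m - n))
      (fun m => (by fun_prop : Continuous _).aestronglyMeasurable) (fun m => ?_)
      (.of_forall fun _ _ => hS) intervalIntegrable_const ?_
    · refine .of_forall fun θ _ => le_of_eq ?_
      rw [norm_mul, norm_mul, norm_zpow, norm_real, Real.norm_of_nonneg hρ.le,
        show ((m - n : ℤ) * (θ * I) : ℂ) = (((m - n : ℤ) * θ : ℝ) : ℂ) * I by push_cast; ring,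
        norm_exp_ofReal_mul_I, mul_one]
    · refine .of_forall fun θ _ => ?_
      simp_rw [← hterm]
      exact (hsum θ).mul_right _
  simp_rw [intervalIntegral.integral_const_mul, integral_exp_int_mul_I] at key
  have hsingle := hasSum_single (f := fun m : ℤ => a m * (ρ : ℂ) ^ (m - n) *
    if m - n = 0 then 2 * (Real.pi : ℂ) else 0) n (fun m hm => by
      rw [if_neg (sub_ne_zero.mpr hm), mul_zero])
  have h0 : (Real.pi : ℂ) ≠ 0 := by exact_mod_cast Real.pi_ne_zero
  have key' := key.unique hsingle
  rw [key']
  simp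
  field_simp

theorem IsLaurentExpansionOn.unique {f : ℂ → ℂ} {a b : ℤ → ℂ} {r R : ℝ} (hr : 0 ≤ r) (hrR : r < R)
    (ha : IsLaurentExpansionOn f a r R) (hb : IsLaurentExpansionOn f b r R) : a = b := by
  obtain ⟨ρ, h1, h2⟩ := exists_between hrR
  funext n
  rw [ha.coeff_eq (hr.trans_lt h1) h1 h2, hb.coeff_eq (hr.trans_lt h1) h1 h2]

theorem laurentCoeff_eq {f : ℂ → ℂ} {a : ℤ → ℂ} {r R : ℝ} (hr : 0 ≤ r) (hrR : r < R)
    (ha : IsLaurentExpansionOn f a r R) (n : ℤ) : laurentCoeff f r R n = a n := by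
  have h : ∃ a : ℤ → ℂ, IsLaurentExpansionOn f a r R := ⟨a, ha⟩
  rw [laurentCoeff, dif_pos h, h.choose_spec.unique hr hrR ha]

theorem hasSum_mul_of_hasSum {f g : ℕ → ℂ} {A B : ℂ} (hA : HasSum f A) (hB : HasSum g B) :
    HasSum (fun p : ℕ × ℕ => f p.1 * g p.2) (A * B) :=
  hA.mul hB (summable_mul_of_summable_norm hA.summable.norm hB.summable.norm)

/-- Grouping a double series in `ζ` and `q / ζ` by powers of `ζ`. -/
theorem hasSum_laurent_of_hasSum_mul {b c : ℕ → ℂ} {q ζ A B : ℂ} (hζ : ζ ≠ 0)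
    (hA : HasSum (fun m => b m * ζ ^ m) A) (hB : HasSum (fun m => c m * (ζ⁻¹ * q) ^ m) B) :
    HasSum (fun n : ℤ => (∑' p : {p : ℕ × ℕ // (p.1 : ℤ) - p.2 = n},
      b p.1.1 * (c p.1.2 * q ^ p.1.2)) * ζ ^ n) (A * B) := by
  have hprod : HasSum (fun p : ℕ × ℕ => b p.1 * ζ ^ p.1 * (c p.2 * (ζ⁻¹ * q) ^ p.2)) (A * B) :=
    hasSum_mul_of_hasSum (f := fun m => b m * ζ ^ m) (g := fun m => c m * (ζ⁻¹ * q) ^ m) hA hB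
  -- The absolutely convergent double series is summed along the fibres of `(i, j) ↦ i - j`, the
  -- exponent of `ζ`.
  have hsig := (Equiv.sigmaFiberEquiv fun p : ℕ × ℕ => (p.1 : ℤ) - p.2).hasSum_iff.mpr hprod
  refine hsig.sigma fun n => ?_
  have hfib (p : {p : ℕ × ℕ // (p.1 : ℤ) - p.2 = n}) :
      b p.1.1 * ζ ^ p.1.1 * (c p.1.2 * (ζ⁻¹ * q) ^ p.1.2) =
        b p.1.1 * (c p.1.2 * q ^ p.1.2) * ζ ^ n := by
    obtain ⟨⟨i, j⟩, rfl⟩ := p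
    simp only [zpow_sub₀ hζ, zpow_natCast, mul_pow, inv_pow]
    field_simp
  have h1 : Summable fun p : {p : ℕ × ℕ // (p.1 : ℤ) - p.2 = n} =>
      b p.1.1 * ζ ^ p.1.1 * (c p.1.2 * (ζ⁻¹ * q) ^ p.1.2) :=
    hprod.summable.subtype {p : ℕ × ℕ | (p.1 : ℤ) - p.2 = n}
  have h2 : (fun p : {p : ℕ × ℕ // (p.1 : ℤ) - p.2 = n} =>
      b p.1.1 * ζ ^ p.1.1 * (c p.1.2 * (ζ⁻¹ * q) ^ p.1.2)) =
      fun p => b p.1.1 * (c p.1.2 * q ^ p.1.2) * ζ ^ n := funext hfib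
  have h3 := h1.hasSum
  rw [h2, tsum_mul_right] at h3
  convert h3 using 1
  funext p
  exact hfib p

/-- A product `g ζ * g (q / ζ)` with `g` holomorphic on the unit disc has a Laurent expansion on
the annulus `‖q‖ < ‖ζ‖ < 1`. -/
theorem exists_isLaurentExpansionOn_mul {g : ℂ → ℂ} {q : ℂ}
    (hg : DifferentiableOn ℂ g (Metric.ball 0 1)) :
    ∃ a : ℤ → ℂ, IsLaurentExpansionOn (fun ζ => g ζ * g (ζ⁻¹ * q)) a ‖q‖ 1 := by
  obtain ⟨b, hb⟩ : ∃ b : ℕ → ℂ, ∀ z : ℂ, ‖z‖ < 1 → HasSum (fun m => b m * z ^ m) (g z) := by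
    refine ⟨fun m => (m.factorial : ℂ)⁻¹ * iteratedDeriv m g 0, fun z hz => ?_⟩
    have h := Complex.hasSum_taylorSeries_on_ball (r := 1) (c := 0) (f := g) (by simpa using hg)
      (z := z) (by simpa using hz)
    have e : (fun m : ℕ => (m.factorial : ℂ)⁻¹ * iteratedDeriv m g 0 * z ^ m) =
        fun m : ℕ => (m.factorial : ℂ)⁻¹ • (z - 0) ^ m • iteratedDeriv m g 0 := by
      funext m
      simp only [sub_zero, smul_eq_mul]
      ring
    rw [e]
    exact h
  refine ⟨fun n => ∑' p : {p : ℕ × ℕ // (p.1 : ℤ) - p.2 = n}, b p.1.1 * (b p.1.2 * q ^ p.1.2),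
    fun ζ h1 h2 => ?_⟩
  have hζ : ζ ≠ 0 := norm_pos_iff.mp ((norm_nonneg q).trans_lt h1)
  have h3 : ‖ζ⁻¹ * q‖ < 1 := by
    rw [norm_mul, norm_inv, inv_mul_lt_one₀ (norm_pos_iff.mpr hζ)]
    exact h1
  exact hasSum_laurent_of_hasSum_mul hζ (hb ζ h2) (hb _ h3)

/-- Up to the constant `(q)_∞`, the function is `g(ζ) g(q/ζ)` with `g(z) = (z)_∞^(-ℓ)`, holomorphic
on the unit disc because `(z)_∞` has no zero there. -/
theorem exists_isLaurentExpansionOn_charGen (ℓ : ℕ) {q : ℂ} (hq : ‖q‖ < 1) :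
    ∃ a : ℤ → ℂ, IsLaurentExpansionOn (charGen ℓ q) a ‖q‖ 1 := by
  have hg : DifferentiableOn ℂ (fun z => (qPochInf z q ^ ℓ)⁻¹) (Metric.ball 0 1) :=
    ((differentiableOn_qPochInf hq).pow ℓ).inv fun z hz =>
      pow_ne_zero _ (qPochInf_ne_zero hq (by simpa using hz))
  obtain ⟨a, ha⟩ := exists_isLaurentExpansionOn_mul (q := q) hg
  refine ⟨fun n => qPochInf q q * a n, fun ζ h1 h2 => ?_⟩
  have := (ha ζ h1 h2).mul_left (qPochInf q q)
  simp only [charGen, div_eq_mul_inv, mul_inv, mul_assoc] at this ⊢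
  exact this

theorem existsUnique_isLaurentExpansionOn_charGen (ℓ : ℕ) {q : ℂ} (hq : ‖q‖ < 1) :
    ∃! a : ℤ → ℂ, IsLaurentExpansionOn (charGen ℓ q) a ‖q‖ 1 := by
  obtain ⟨a, ha⟩ := exists_isLaurentExpansionOn_charGen ℓ hq
  exact ⟨a, ha, fun b hb => hb.unique (norm_nonneg _) hq ha⟩

theorem laurentCoeff_charGen (ℓ : ℕ) {q : ℂ} (hq : ‖q‖ < 1) {ρ : ℝ} (h0 : 0 < ρ) (h1 : ‖q‖ < ρ)
    (h2 : ρ < 1) (n : ℤ) :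
    laurentCoeff (charGen ℓ q) ‖q‖ 1 n = (2 * Real.pi : ℂ)⁻¹ * ∫ θ in (-Real.pi)..Real.pi,
      charGen ℓ q (ρ * exp (θ * I)) * (ρ * exp (θ * I)) ^ (-n) := by
  obtain ⟨a, ha⟩ := exists_isLaurentExpansionOn_charGen ℓ hq
  rw [laurentCoeff_eq (norm_nonneg _) hq ha, ha.coeff_eq h0 h1 h2]

end Laurent

/-! ### The theta function on the middle circle after modular inversion. -/

section Theta

open Complex

/-- The terms of the theta series after the modular transformation. -/
noncomputable def thetaDualTerm (t u : ℝ) (n : ℤ) : ℝ :=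
  Real.exp ((2 * n - 1) * (Real.pi * u) - 2 * Real.pi ^ 2 * (n * (n - 1)) / t)

/-- The theta series after the modular transformation, normalized so that the terms `n = 0, 1`
add up to `2 cosh (π u)`. -/
noncomputable def thetaDual (t u : ℝ) : ℝ := ∑' n : ℤ, thetaDualTerm t u n

/-- The arguments are `z/τ` and `-1/τ` for `τ = it/2π` and `z = tu/2π + 1/2`. The factor `e^(-πu)`
makes the terms `n = 0` and `n = 1` mirror images. -/
theorem ofReal_thetaDualTerm {t : ℝ} (ht : 0 < t) (u : ℝ) (n : ℤ) :
    (thetaDualTerm t u n : ℂ) = exp (-(Real.pi * u)) * jacobiTheta₂_term n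
      ((t * u / (2 * Real.pi) + 1 / 2) / (I * t / (2 * Real.pi))) (-1 / (I * t / (2 * Real.pi))) := by
  have hpi : (Real.pi : ℂ) ≠ 0 := by exact_mod_cast Real.pi_ne_zero
  have htc : (t : ℂ) ≠ 0 := by exact_mod_cast ht.ne'
  rw [thetaDualTerm, jacobiTheta₂_term, ofReal_exp, ← exp_add]
  congr 1
  push_cast
  field_simp
  ring

theorem im_neg_one_div_pos {t : ℝ} (ht : 0 < t) : 0 < (-1 / (I * t / (2 * Real.pi)) : ℂ).im := by
  have hpi := Real.pi_pos
  have : (-1 / (I * t / (2 * Real.pi)) : ℂ) = ((2 * Real.pi / t : ℝ) : ℂ) * I := by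
    have hpi : (Real.pi : ℂ) ≠ 0 := by exact_mod_cast Real.pi_ne_zero
    have htc : (t : ℂ) ≠ 0 := by exact_mod_cast ht.ne'
    push_cast
    field_simp
    simp
  rw [this, im_ofReal_mul, I_im, mul_one]
  positivity

theorem summable_thetaDualTerm {t : ℝ} (ht : 0 < t) (u : ℝ) : Summable (thetaDualTerm t u) := by
  rw [← summable_ofReal]
  simp_rw [ofReal_thetaDualTerm ht]
  exact ((summable_jacobiTheta₂_term_iff _ _).mpr (im_neg_one_div_pos ht)).mul_left _

theorem ofReal_thetaDual {t : ℝ} (ht : 0 < t) (u : ℝ) :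
    (thetaDual t u : ℂ) = exp (-(Real.pi * u)) * jacobiTheta₂
      ((t * u / (2 * Real.pi) + 1 / 2) / (I * t / (2 * Real.pi))) (-1 / (I * t / (2 * Real.pi))) := by
  rw [thetaDual, ofReal_tsum, jacobiTheta₂, ← tsum_mul_left]
  exact tsum_congr fun n => ofReal_thetaDualTerm ht u n

theorem continuous_thetaDual {t : ℝ} (ht : 0 < t) : Continuous (thetaDual t) := by
  have hd : Continuous fun z : ℂ => jacobiTheta₂ z (-1 / (I * t / (2 * Real.pi))) :=
    continuous_iff_continuousAt.mpr fun z =>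
      (differentiableAt_jacobiTheta₂_fst z (im_neg_one_div_pos ht)).continuousAt
  have h : Continuous fun u : ℝ => (thetaDual t u : ℂ) := by
    simp_rw [ofReal_thetaDual ht]
    refine Continuous.mul (by fun_prop) (hd.comp (by fun_prop))
  exact (continuous_re.comp h).congr fun u => by simp

theorem thetaDualTerm_pos (t u : ℝ) (n : ℤ) : 0 < thetaDualTerm t u n := Real.exp_pos _

theorem sum_thetaDualTerm_zero_one (t u : ℝ) :
    ∑ n ∈ ({0, 1} : Finset ℤ), thetaDualTerm t u n = 2 * Real.cosh (Real.pi * u) := by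
  rw [Finset.sum_pair zero_ne_one, Real.cosh_eq]
  simp only [thetaDualTerm]
  norm_num
  ring_nf

/-- All terms are positive, so those other than `n = 0, 1` may be dropped. This bound, uniform in
`t`, drives the later domination. -/
theorem two_mul_cosh_le_thetaDual {t : ℝ} (ht : 0 < t) (u : ℝ) :
    2 * Real.cosh (Real.pi * u) ≤ thetaDual t u := by
  rw [← sum_thetaDualTerm_zero_one t u]
  exact (summable_thetaDualTerm ht u).sum_le_tsum _ fun n _ => (thetaDualTerm_pos t u n).le

theorem int_mul_sub_one_nonneg (n : ℤ) : (0 : ℝ) ≤ n * (n - 1) := by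
  have : (0 : ℤ) ≤ n * (n - 1) := by
    rcases le_or_gt n 0 with h | h
    · exact mul_nonneg_of_nonpos_of_nonpos h (by omega)
    · exact mul_nonneg h.le (by omega)
  exact_mod_cast this

/-- The terms `n = 0, 1` do not depend on `t`; for the others `n(n-1) > 0` and the term vanishes in
the limit. Each term is nondecreasing in `t`, so the series at `t = 1` dominates on `0 < t ≤ 1`. -/
theorem tendsto_thetaDual (u : ℝ) :
    Tendsto (fun t => thetaDual t u) (𝓝[>] 0) (𝓝 (2 * Real.cosh (Real.pi * u))) := by
  have hlim : Tendsto (fun t => thetaDual t u) (𝓝[>] 0)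
      (𝓝 (∑' n : ℤ, if n ∈ ({0, 1} : Finset ℤ) then thetaDualTerm 1 u n else 0)) := by
    refine tendsto_tsum_of_dominated_convergence (summable_thetaDualTerm one_pos u)
      (fun n => ?_) ?_
    · split_ifs with h
      · have : ∀ t, thetaDualTerm t u n = thetaDualTerm 1 u n := by
          intro t
          have h' : n = 0 ∨ n = 1 := by simpa using h
          rcases h' with rfl | rfl <;> simp [thetaDualTerm]
        simp_rw [this]
        exact tendsto_const_nhds
      · have hn : (0 : ℝ) < n * (n - 1) := by
          refine lt_of_le_of_ne (int_mul_sub_one_nonneg n) fun h0 => h ?_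
          rcases mul_eq_zero.mp h0.symm with h1 | h1
          · simp [Int.cast_eq_zero.mp h1]
          · simp [show n = 1 by exact_mod_cast sub_eq_zero.mp h1]
        have hc : 0 < 2 * Real.pi ^ 2 * (n * (n - 1)) := by positivity
        have h1 : Tendsto (fun t : ℝ => 2 * Real.pi ^ 2 * (n * (n - 1)) / t) (𝓝[>] 0) atTop := by
          simpa only [div_eq_mul_inv] using tendsto_inv_nhdsGT_zero.const_mul_atTop hc
        exact Real.tendsto_exp_atBot.comp
          (tendsto_atBot_add_const_left _ _ (tendsto_neg_atTop_atBot.comp h1))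
    · filter_upwards [Ioc_mem_nhdsGT (zero_lt_one' ℝ)] with t ht n
      rw [Real.norm_of_nonneg (thetaDualTerm_pos t u n).le]
      have := int_mul_sub_one_nonneg n
      exact Real.exp_le_exp.mpr (sub_le_sub_left
        (div_le_div_of_nonneg_left (by positivity) ht.1 ht.2) _)
  rw [tsum_eq_sum (s := {0, 1}) (fun n hn => if_neg hn)] at hlim
  rw [← sum_thetaDualTerm_zero_one 1 u]
  convert hlim using 2
  exact Finset.sum_congr rfl fun n hn => (if_pos hn).symm

/-- The modular transformation of the triple product on the circle `‖ζ‖ = q ^ (1 / 2)`. -/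
theorem triple_product_eq_thetaDual {t : ℝ} (ht : 0 < t) (u : ℝ) {q ζ : ℂ}
    (hq : q = (Real.exp (-t) : ℝ))
    (hζ : ζ = (Real.exp (-t / 2) : ℝ) * exp ((t * u : ℝ) * I)) :
    qPochInf ζ q * qPochInf (ζ⁻¹ * q) q * qPochInf q q =
      (((t / (2 * Real.pi)) ^ (-(1 / 2 : ℝ)) *
        Real.exp (-(Real.pi ^ 2 / (2 * t)) - t * u ^ 2 / 2) * thetaDual t u : ℝ) : ℂ) := by
  have hpi := Real.pi_pos
  have hpic : (Real.pi : ℂ) ≠ 0 := by exact_mod_cast Real.pi_ne_zero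
  have htc : (t : ℂ) ≠ 0 := by exact_mod_cast ht.ne'
  have hy0 : 0 < t / (2 * Real.pi) := by positivity
  have hτ : 0 < (I * t / (2 * Real.pi) : ℂ).im := by
    rw [show (I * t / (2 * Real.pi) : ℂ) = ((t / (2 * Real.pi) : ℝ) : ℂ) * I by push_cast; ring,
      im_ofReal_mul, I_im, mul_one]
    exact hy0
  -- The summand `τ/2` of `z` encodes the radius `e^(-t/2)` and cancels the shift `-τ/2` in the
  -- triple product, leaving the real argument `tu/2π + 1/2`.
  rw [jacobi_triple_product (t * u / (2 * Real.pi) + (I * t / (2 * Real.pi)) / 2) hτ (q := q)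
    (ζ := ζ) ?_ ?_]
  · rw [show (t * u / (2 * Real.pi) + (I * t / (2 * Real.pi)) / 2 + 1 / 2 -
      (I * t / (2 * Real.pi)) / 2 : ℂ) = t * u / (2 * Real.pi) + 1 / 2 by ring,
      jacobiTheta₂_functional_equation, ofReal_mul, ofReal_thetaDual ht, ← mul_assoc]
    congr 1
    rw [ofReal_mul, ofReal_exp, mul_assoc (ofReal _), ← exp_add]
    congr 1
    · rw [show (-I * (I * t / (2 * Real.pi)) : ℂ) = ((t / (2 * Real.pi) : ℝ) : ℂ) by
        push_cast; linear_combination (-(t : ℂ) / (2 * Real.pi)) * I_mul_I,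
        ofReal_cpow hy0.le]
      push_cast
      rw [cpow_neg, one_div]
    · congr 1
      push_cast
      field_simp
      ring
  · rw [hq, ofReal_exp]
    congr 1
    push_cast
    field_simp
    simp
  · rw [hζ, ofReal_exp, ← exp_add]
    congr 1
    push_cast
    field_simp
    linear_combination -I_sq

end Theta

/-! ### The behaviour of `(q)_∞` as `q → 1`, from the Dedekind eta function. -/

section Eta

open Complex ModularForm
open UpperHalfPlane hiding I

/-- After inversion the nome is `e^(-4π²/t) → 0`, so the transformed Pochhammer factor contributes
`1` in the limit. -/
theorem tendsto_qPochInf_self_nhds_zero : Tendsto (fun q : ℂ => qPochInf q q) (𝓝 0) (𝓝 1) := by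
  have hfun : (fun q : ℂ => qPochInf q q) = fun q => ∏' n : ℕ, (1 - q ^ (n + 1)) := by
    funext q
    simp only [qPochInf, pow_succ']
  rw [hfun]
  have h := (differentiableOn_tprod_one_sub_pow.continuousOn).continuousAt
    (Metric.ball_mem_nhds (0 : ℂ) one_pos)
  simpa [ContinuousAt] using h

theorem eta_mul_I (y : ℝ) :
    ModularForm.eta (I * y) = exp (-(Real.pi * y / 12)) *
      qPochInf (exp (-(2 * Real.pi * y))) (exp (-(2 * Real.pi * y))) := by
  have h1 : 2 * (Real.pi : ℂ) * I * (I * y) = -(2 * Real.pi * y) := by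
    linear_combination (2 * Real.pi * y : ℂ) * I_mul_I
  simp only [ModularForm.eta, qPochInf, eta_q_eq_cexp]
  congr 1
  · rw [Function.Periodic.qParam]
    congr 1
    push_cast
    linear_combination (Real.pi * y / 12 : ℂ) * I_mul_I
  · refine tprod_congr fun n => ?_
    rw [← pow_succ', ← exp_nat_mul]
    congr 2
    push_cast
    linear_combination (n + 1 : ℂ) * h1

/-- The modular transformation of `(q; q)_∞` at `q = e ^ (-t)`. -/
theorem qPochInf_exp_neg {t : ℝ} (ht : 0 < t) :
    qPochInf (Real.exp (-t) : ℝ) (Real.exp (-t) : ℝ) =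
      ((Real.exp (t / 24) * (t / (2 * Real.pi)) ^ (-(1 / 2 : ℝ)) *
        Real.exp (-(Real.pi ^ 2 / (6 * t))) : ℝ) : ℂ) *
      qPochInf (Real.exp (-(4 * Real.pi ^ 2 / t)) : ℝ) (Real.exp (-(4 * Real.pi ^ 2 / t)) : ℝ) := by
  have hpi := Real.pi_pos
  set y : ℝ := t / (2 * Real.pi) with hy
  have hy0 : 0 < y := by positivity
  have hz : I * (y : ℂ) ∈ upperHalfPlaneSet := by simpa [upperHalfPlaneSet] using hy0
  have hS := eta_comp_eq_csqrt_I_inv hz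
  have hyc : (y : ℂ) ≠ 0 := by exact_mod_cast hy0.ne'
  have e1 : -1 / (I * (y : ℂ)) = I * ((1 / y : ℝ) : ℂ) := by
    push_cast
    field_simp
    simp
  -- Since `y > 0`, the complex root splits without a branch correction, and `sqrt I` cancels the
  -- constant in the eta transformation.
  have e2 : sqrt (I * (y : ℂ)) = sqrt I * ((y ^ (1 / 2 : ℝ) : ℝ) : ℂ) := by
    rw [sqrt, sqrt, mul_comm, cpow_def_of_ne_zero (mul_ne_zero hyc I_ne_zero),
      cpow_def_of_ne_zero I_ne_zero, log_ofReal_mul hy0 I_ne_zero, Real.rpow_def_of_pos hy0,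
      ofReal_exp, ← exp_add]
    congr 1
    push_cast
    ring
  have e3 : sqrt I ≠ 0 := by simp [sqrt]
  have hS' : ModularForm.eta (I * ((1 / y : ℝ) : ℂ)) =
      ((y ^ (1 / 2 : ℝ) : ℝ) : ℂ) * ModularForm.eta (I * y) := by
    rw [← e1]
    simp only [Function.comp_apply, Pi.smul_apply, Pi.mul_apply, smul_eq_mul, e2] at hS
    rw [hS]
    field_simp
  rw [eta_mul_I, eta_mul_I] at hS'
  have a1 : exp (-(2 * Real.pi * y)) = (Real.exp (-t) : ℝ) := by
    rw [ofReal_exp]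
    congr 1
    rw [hy]
    push_cast
    field_simp
  have a2 : exp (-(2 * Real.pi * (1 / y : ℝ))) = (Real.exp (-(4 * Real.pi ^ 2 / t)) : ℝ) := by
    rw [ofReal_exp]
    congr 1
    rw [hy]
    push_cast
    field_simp
    ring
  have a3 : exp (-(Real.pi * y / 12)) = ((Real.exp (t / 24))⁻¹ : ℝ) := by
    rw [← Real.exp_neg, ofReal_exp]
    congr 1
    rw [hy]
    push_cast
    field_simp
    ring
  have a4 : exp (-(Real.pi * (1 / y : ℝ) / 12)) = (Real.exp (-(Real.pi ^ 2 / (6 * t))) : ℝ) := by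
    rw [ofReal_exp]
    congr 1
    rw [hy]
    push_cast
    field_simp
    ring
  rw [a1, a2, a3, a4] at hS'
  rw [Real.rpow_neg hy0.le]
  have b1 : ((Real.exp (t / 24) : ℝ) : ℂ) ≠ 0 := by exact_mod_cast (Real.exp_pos _).ne'
  have b2 : ((y ^ (1 / 2 : ℝ) : ℝ) : ℂ) ≠ 0 := by exact_mod_cast (Real.rpow_pos_of_pos hy0 _).ne'
  simp only [ofReal_mul, ofReal_inv] at hS' ⊢
  rw [mul_assoc, hS']
  field_simp

end Eta

/-! ### Evaluation of the limiting hyperbolic cosine integral. -/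

section CoshIntegral

open MeasureTheory Set

theorem integrable_exp_neg_mul_abs {c : ℝ} (hc : 0 < c) :
    Integrable fun x : ℝ => Real.exp (-(c * |x|)) := by
  rw [← integrableOn_univ, ← Iic_union_Ioi (a := (0 : ℝ))]
  refine IntegrableOn.union ?_ ?_
  · refine (integrableOn_exp_mul_Iic hc 0).congr_fun (fun x hx => ?_) measurableSet_Iic
    simp [abs_of_nonpos (mem_Iic.mp hx)]
  · refine (integrableOn_exp_mul_Ioi (neg_neg_of_pos hc) 0).congr_fun (fun x hx => ?_)
      measurableSet_Ioi
    simp [abs_of_pos (mem_Ioi.mp hx)]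

theorem exp_abs_le_two_mul_cosh (x : ℝ) : Real.exp |x| ≤ 2 * Real.cosh x := by
  rw [← Real.cosh_abs, Real.cosh_eq]
  linarith [Real.exp_pos (-|x|)]

theorem inv_cosh_pow_le {n : ℕ} (hn : n ≠ 0) (u : ℝ) :
    (Real.cosh (Real.pi * u) ^ n)⁻¹ ≤ 2 * Real.exp (-(Real.pi * |u|)) := by
  have h1 := Real.one_le_cosh (Real.pi * u)
  have h2 := exp_abs_le_two_mul_cosh (Real.pi * u)
  rw [abs_mul, abs_of_pos Real.pi_pos] at h2
  rw [Real.exp_neg, ← div_eq_mul_inv, inv_eq_one_div, div_le_div_iff₀ (by positivity)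
    (Real.exp_pos _), one_mul]
  exact h2.trans (mul_le_mul_of_nonneg_left (le_self_pow₀ h1 hn) zero_le_two)

theorem integrable_inv_cosh_pow {n : ℕ} (hn : n ≠ 0) :
    Integrable fun u : ℝ => (Real.cosh (Real.pi * u) ^ n)⁻¹ := by
  refine ((integrable_exp_neg_mul_abs Real.pi_pos).const_mul 2).mono'
    (Continuous.aestronglyMeasurable ?_) (.of_forall fun u => ?_)
  · exact Continuous.inv₀ (by fun_prop) fun u => (pow_pos (Real.cosh_pos _) n).ne'
  · rw [Real.norm_of_nonneg (by have := Real.cosh_pos (Real.pi * u); positivity)]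
    exact inv_cosh_pow_le hn u

theorem tendsto_exp_neg_pi_mul_abs {l : Filter ℝ} (hl : Tendsto (fun u : ℝ => |u|) l atTop) :
    Tendsto (fun u : ℝ => 2 * Real.exp (-(Real.pi * |u|))) l (𝓝 0) := by
  have h := Real.tendsto_exp_atBot.comp
    (tendsto_neg_atTop_atBot.comp (hl.const_mul_atTop Real.pi_pos))
  simpa using h.const_mul 2

theorem hasDerivAt_cosh_pi_mul (u : ℝ) :
    HasDerivAt (fun u : ℝ => Real.cosh (Real.pi * u)) (Real.pi * Real.sinh (Real.pi * u)) u := by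
  have := ((hasDerivAt_id u).const_mul Real.pi).cosh
  simpa [mul_comm] using this

theorem hasDerivAt_sinh_pi_mul (u : ℝ) :
    HasDerivAt (fun u : ℝ => Real.sinh (Real.pi * u)) (Real.pi * Real.cosh (Real.pi * u)) u := by
  have := ((hasDerivAt_id u).const_mul Real.pi).sinh
  simpa [mul_comm] using this

/-- The difference of the two integrands is, up to a factor `π`, the derivative of `sinh(πu) /
cosh(πu)^(n+1)`, which vanishes at both ends because `n ≥ 1`. -/
theorem integral_inv_cosh_pow_add_two {n : ℕ} (hn : n ≠ 0) :
    (n + 1) * ∫ u : ℝ, (Real.cosh (Real.pi * u) ^ (n + 2))⁻¹ =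
      n * ∫ u : ℝ, (Real.cosh (Real.pi * u) ^ n)⁻¹ := by
  have hd (u : ℝ) : HasDerivAt
      (fun u : ℝ => Real.sinh (Real.pi * u) / Real.cosh (Real.pi * u) ^ (n + 1))
      (Real.pi * ((n + 1) * (Real.cosh (Real.pi * u) ^ (n + 2))⁻¹ -
        n * (Real.cosh (Real.pi * u) ^ n)⁻¹)) u := by
    have hc : Real.cosh (Real.pi * u) ≠ 0 := (Real.cosh_pos _).ne'
    refine ((hasDerivAt_sinh_pi_mul u).div ((hasDerivAt_cosh_pi_mul u).pow (n + 1))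
      (pow_ne_zero _ hc)).congr_deriv ?_
    have hs := Real.sinh_sq (Real.pi * u)
    simp only [Nat.add_sub_cancel, Nat.cast_add, Nat.cast_one, Pi.pow_apply]
    have e1 : (Real.cosh (Real.pi * u) ^ (n + 2))⁻¹ * (Real.cosh (Real.pi * u) ^ (n + 1)) ^ 2 =
        Real.cosh (Real.pi * u) ^ n := by
      field_simp
      ring
    have e2 : (Real.cosh (Real.pi * u) ^ n)⁻¹ * (Real.cosh (Real.pi * u) ^ (n + 1)) ^ 2 =
        Real.cosh (Real.pi * u) ^ (n + 2) := by
      field_simp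
      ring
    rw [div_eq_iff (pow_ne_zero _ (pow_ne_zero _ hc))]
    linear_combination (-(n + 1 : ℝ)) * Real.pi * Real.cosh (Real.pi * u) ^ n * hs -
      Real.pi * (n + 1) * e1 + Real.pi * n * e2
  have hlim {l : Filter ℝ} (hl : Tendsto (fun u : ℝ => |u|) l atTop) :
      Tendsto (fun u : ℝ => Real.sinh (Real.pi * u) / Real.cosh (Real.pi * u) ^ (n + 1)) l
        (𝓝 0) := by
    refine squeeze_zero_norm (fun u => ?_) (tendsto_exp_neg_pi_mul_abs hl)
    refine le_trans ?_ (inv_cosh_pow_le hn u)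
    have hc := Real.cosh_pos (Real.pi * u)
    have hs : |Real.sinh (Real.pi * u)| ≤ Real.cosh (Real.pi * u) := by
      refine abs_le_of_sq_le_sq ?_ hc.le
      rw [Real.sinh_sq]
      linarith
    rw [Real.norm_eq_abs, abs_div, abs_of_pos (pow_pos hc _), pow_succ, inv_eq_one_div,
      div_le_div_iff₀ (by positivity) (by positivity), one_mul, mul_comm]
    gcongr
  have h := integral_of_hasDerivAt_of_tendsto hd
    ((((integrable_inv_cosh_pow (by omega)).const_mul _).sub
      ((integrable_inv_cosh_pow hn).const_mul _)).const_mul _)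
    (hlim tendsto_abs_atBot_atTop) (hlim tendsto_abs_atTop_atTop)
  rw [integral_const_mul, integral_sub ((integrable_inv_cosh_pow (by omega)).const_mul _)
    ((integrable_inv_cosh_pow hn).const_mul _), integral_const_mul, integral_const_mul,
    sub_zero, mul_eq_zero, sub_eq_zero] at h
  exact h.resolve_left Real.pi_ne_zero

theorem integral_inv_cosh : ∫ u : ℝ, (Real.cosh (Real.pi * u) ^ 1)⁻¹ = 1 := by
  have hpi := Real.pi_pos
  have hd (u : ℝ) : HasDerivAt (fun u : ℝ => Real.arctan (Real.sinh (Real.pi * u)) / Real.pi)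
      (Real.cosh (Real.pi * u) ^ 1)⁻¹ u := by
    have hc : Real.cosh (Real.pi * u) ≠ 0 := (Real.cosh_pos _).ne'
    refine ((hasDerivAt_sinh_pi_mul u).arctan.div_const Real.pi).congr_deriv ?_
    rw [add_comm, ← Real.cosh_sq]
    field_simp
  have htop : Tendsto (fun u : ℝ => Real.sinh (Real.pi * u)) atTop atTop :=
    Real.sinhOrderIso.tendsto_atTop.comp (tendsto_id.const_mul_atTop hpi)
  have hbot : Tendsto (fun u : ℝ => Real.sinh (Real.pi * u)) atBot atBot :=
    Real.sinhOrderIso.tendsto_atBot.comp (tendsto_id.const_mul_atBot hpi)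
  rw [integral_of_hasDerivAt_of_tendsto hd (integrable_inv_cosh_pow one_ne_zero)
    (((tendsto_nhds_of_tendsto_nhdsWithin Real.tendsto_arctan_atBot).comp hbot).div_const _)
    (((tendsto_nhds_of_tendsto_nhdsWithin Real.tendsto_arctan_atTop).comp htop).div_const _)]
  field_simp
  norm_num

theorem integral_inv_cosh_sq : ∫ u : ℝ, (Real.cosh (Real.pi * u) ^ 2)⁻¹ = 2 / Real.pi := by
  have hpi := Real.pi_pos
  have hd (u : ℝ) : HasDerivAt
      (fun u : ℝ => Real.sinh (Real.pi * u) / Real.cosh (Real.pi * u) / Real.pi)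
      (Real.cosh (Real.pi * u) ^ 2)⁻¹ u := by
    have hc : Real.cosh (Real.pi * u) ≠ 0 := (Real.cosh_pos _).ne'
    refine (((hasDerivAt_sinh_pi_mul u).div (hasDerivAt_cosh_pi_mul u) hc).div_const
      Real.pi).congr_deriv ?_
    have hs := Real.sinh_sq (Real.pi * u)
    field_simp
    linear_combination -hs
  have hexp {l : Filter ℝ} (hl : Tendsto (fun u : ℝ => |u|) l atTop) :
      Tendsto (fun u : ℝ => Real.exp (-|Real.pi * u|) / Real.cosh (Real.pi * u)) l (𝓝 0) := by
    refine squeeze_zero (fun u => by have := Real.cosh_pos (Real.pi * u); positivity) (fun u => ?_)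
      (tendsto_exp_neg_pi_mul_abs hl)
    rw [abs_mul, abs_of_pos hpi]
    refine (div_le_self (Real.exp_pos _).le (Real.one_le_cosh _)).trans ?_
    linarith [Real.exp_pos (-(Real.pi * |u|))]
  have htop : Tendsto (fun u : ℝ => Real.sinh (Real.pi * u) / Real.cosh (Real.pi * u) / Real.pi)
      atTop (𝓝 (1 / Real.pi)) := by
    refine Tendsto.div_const ?_ _
    -- For `x ≥ 0`, `tanh x = 1 - e^(-x) / cosh x`; the limit at `-∞` then follows by oddness.
    have h := (tendsto_const_nhds (x := (1 : ℝ))).sub (hexp tendsto_abs_atTop_atTop)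
    rw [sub_zero] at h
    refine h.congr' ?_
    filter_upwards [eventually_ge_atTop 0] with u hu
    have hc : Real.cosh (Real.pi * u) ≠ 0 := (Real.cosh_pos _).ne'
    rw [abs_of_nonneg (by positivity), ← Real.cosh_sub_sinh]
    field_simp
    ring
  have hbot : Tendsto (fun u : ℝ => Real.sinh (Real.pi * u) / Real.cosh (Real.pi * u) / Real.pi)
      atBot (𝓝 (-1 / Real.pi)) := by
    have h := (htop.comp tendsto_neg_atBot_atTop).neg
    rw [← neg_div] at h
    refine h.congr fun u => ?_
    simp [neg_div]
  rw [integral_of_hasDerivAt_of_tendsto hd (integrable_inv_cosh_pow two_ne_zero) hbot htop]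
  ring

/-- Passing from `n` to `n + 2` multiplies the integral by `(n+1)/(n+2)` and the squared Gamma value
by `((n+2)/2)²`; the right side also gains `(n+1)(n+2)/4`. The step of two requires the base cases
`cosh` and `cosh²`. -/
theorem integral_inv_cosh_pow_mul_Gamma_sq (n : ℕ) :
    (∫ u : ℝ, (Real.cosh (Real.pi * u) ^ (n + 1))⁻¹) *
      Real.Gamma (((n + 1 : ℕ) + 1) / 2) ^ 2 = 2 / 2 ^ (n + 1) * n.factorial := by
  induction n using Nat.twoStepInduction with
  | zero => simpa using integral_inv_cosh
  | one =>
    have h : Real.Gamma (3 / 2) = √Real.pi / 2 := by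
      rw [show (3 / 2 : ℝ) = 1 / 2 + 1 by norm_num, Real.Gamma_add_one (by norm_num),
        Real.Gamma_one_half_eq]
      ring
    rw [show (((1 + 1 : ℕ) : ℝ) + 1) / 2 = 3 / 2 by norm_num, h, integral_inv_cosh_sq, div_pow,
      Real.sq_sqrt Real.pi_pos.le]
    have := Real.pi_ne_zero
    field_simp
    norm_num
  | more n ih _ =>
    have hrec := integral_inv_cosh_pow_add_two (n := n + 1) (by omega)
    have hG : Real.Gamma (((n + 2 + 1 : ℕ) + 1) / 2) =
        ((n : ℝ) + 2) / 2 * Real.Gamma (((n + 1 : ℕ) + 1) / 2) := by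
      rw [show ((((n + 2 + 1 : ℕ) : ℝ) + 1) / 2) = (((n + 1 : ℕ) : ℝ) + 1) / 2 + 1 by
        push_cast; ring, Real.Gamma_add_one (by positivity)]
      push_cast
      ring
    rw [hG, show n + 2 + 1 = n + 1 + 2 by ring, Nat.factorial_succ, Nat.factorial_succ]
    push_cast at hrec ih ⊢
    have e : (2 : ℝ) / 2 ^ (n + 1 + 2) = 2 / 2 ^ (n + 1) / 4 := by
      rw [pow_add _ (n + 1)]
      field_simp
      norm_num
    rw [e]
    have h0 : (n : ℝ) + 2 ≠ 0 := by positivity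
    linear_combination ((n : ℝ) + 2) / 4 * Real.Gamma ((n + 1 + 1) / 2) ^ 2 * hrec +
      ((n : ℝ) + 2) * (n + 1) / 4 * ih

theorem integral_inv_two_mul_cosh_pow {ℓ : ℕ} (hℓ : ℓ ≠ 0) :
    ∫ u : ℝ, ((2 * Real.cosh (Real.pi * u)) ^ ℓ)⁻¹ = charConst ℓ := by
  obtain ⟨n, rfl⟩ := Nat.exists_eq_succ_of_ne_zero hℓ
  have h := integral_inv_cosh_pow_mul_Gamma_sq n
  have hG : Real.Gamma (((n + 1 : ℕ) + 1) / 2) ≠ 0 := (Real.Gamma_pos_of_pos (by positivity)).ne'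
  simp_rw [mul_pow, mul_inv, integral_const_mul]
  rw [charConst, Nat.succ_eq_add_one, eq_div_iff (pow_ne_zero _ hG), mul_assoc, h,
    Nat.add_sub_cancel, zpow_sub₀ two_ne_zero, zpow_mul, zpow_one]
  have : ((2 : ℝ) ^ (2 : ℤ)) ^ ((n + 1 : ℕ) : ℤ) = 2 ^ (n + 1) * 2 ^ (n + 1) := by
    rw [zpow_natCast, ← mul_pow]
    norm_num
  rw [this]
  field_simp

end CoshIntegral

/-! ### Rescaled Cauchy integral, dominated convergence and collection of factors. -/

section Asymptotic

open Complex MeasureTheory Set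

/-- The rescaled integrand of Cauchy's formula for `charF`. -/
noncomputable def charIntegrand (ℓ s : ℕ) (t u : ℝ) : ℂ :=
  (Real.exp (t * u ^ 2 / 2) ^ ℓ * (thetaDual t u ^ ℓ)⁻¹ : ℝ) * exp ((-(s * (t * u)) : ℝ) * I)

theorem thetaDual_pos {t : ℝ} (ht : 0 < t) (u : ℝ) : 0 < thetaDual t u :=
  lt_of_lt_of_le (mul_pos two_pos (Real.cosh_pos _)) (two_mul_cosh_le_thetaDual ht u)

/-- On the range of integration `tu²/2 ≤ π|u|/2`, so the growing Gaussian uses up at most half of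
the decay `e^(-π|u|)` supplied by the theta series. The bound is independent of `t`. -/
theorem norm_charIntegrand_le {ℓ : ℕ} (hℓ : ℓ ≠ 0) (s : ℕ) {t u : ℝ} (ht : 0 < t)
    (hu : t * |u| ≤ Real.pi) : ‖charIntegrand ℓ s t u‖ ≤ Real.exp (-(Real.pi / 2 * |u|)) := by
  have hpi := Real.pi_pos
  have hpos := thetaDual_pos ht u
  rw [charIntegrand, norm_mul, norm_exp_ofReal_mul_I, mul_one, norm_real,
    Real.norm_of_nonneg (by positivity), ← inv_pow, ← mul_pow]
  have h1 : Real.exp (Real.pi * |u|) ≤ thetaDual t u := by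
    have := exp_abs_le_two_mul_cosh (Real.pi * u)
    rw [abs_mul, abs_of_pos hpi] at this
    exact this.trans (two_mul_cosh_le_thetaDual ht u)
  have h2 : Real.exp (t * u ^ 2 / 2) * (thetaDual t u)⁻¹ ≤ Real.exp (-(Real.pi / 2 * |u|)) := by
    calc _ ≤ Real.exp (t * u ^ 2 / 2) * (Real.exp (Real.pi * |u|))⁻¹ := by gcongr
      _ = Real.exp (t * |u| * |u| / 2 - Real.pi * |u|) := by
        rw [← Real.exp_neg, ← Real.exp_add, ← sq_abs u]
        ring_nf
      _ ≤ _ := by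
        refine Real.exp_le_exp.mpr ?_
        have := mul_le_mul_of_nonneg_right hu (abs_nonneg u)
        linarith
  refine (pow_le_pow_left₀ (by positivity) h2 ℓ).trans ?_
  refine pow_le_of_le_one (Real.exp_pos _).le (Real.exp_le_one_iff.mpr ?_) hℓ
  have := mul_nonneg (half_pos hpi).le (abs_nonneg u)
  linarith

theorem continuous_charIntegrand (ℓ s : ℕ) {t : ℝ} (ht : 0 < t) :
    Continuous (charIntegrand ℓ s t) := by
  have h := continuous_thetaDual ht
  refine Continuous.mul (continuous_ofReal.comp (Continuous.mul (by fun_prop) ?_)) (by fun_prop)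
  exact (h.pow ℓ).inv₀ fun u => (pow_pos (thetaDual_pos ht u) ℓ).ne'

theorem tendsto_charIntegrand (ℓ s : ℕ) (u : ℝ) :
    Tendsto (fun t => charIntegrand ℓ s t u) (𝓝[>] 0)
      (𝓝 (((2 * Real.cosh (Real.pi * u)) ^ ℓ)⁻¹ : ℝ)) := by
  have hc : (2 * Real.cosh (Real.pi * u)) ^ ℓ ≠ 0 :=
    (pow_pos (mul_pos two_pos (Real.cosh_pos _)) ℓ).ne'
  have h1 : Tendsto (fun t : ℝ => Real.exp (t * u ^ 2 / 2) ^ ℓ) (𝓝[>] 0) (𝓝 1) := by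
    have : Continuous fun t : ℝ => Real.exp (t * u ^ 2 / 2) ^ ℓ := by fun_prop
    simpa using (this.tendsto 0).mono_left nhdsWithin_le_nhds
  have h2 : Tendsto (fun t : ℝ => exp ((-(s * (t * u)) : ℝ) * I)) (𝓝[>] 0) (𝓝 1) := by
    have : Continuous fun t : ℝ => exp ((-(s * (t * u)) : ℝ) * I) := by fun_prop
    simpa using (this.tendsto 0).mono_left nhdsWithin_le_nhds
  have h3 := h1.mul (((tendsto_thetaDual u).pow ℓ).inv₀ hc)
  simpa [charIntegrand] using ((continuous_ofReal.tendsto _).comp h3).mul h2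

theorem tendsto_integral_charIntegrand {ℓ : ℕ} (hℓ : ℓ ≠ 0) (s : ℕ) :
    Tendsto (fun t => ∫ u in (-(Real.pi / t))..(Real.pi / t), charIntegrand ℓ s t u) (𝓝[>] 0)
      (𝓝 (charConst ℓ : ℂ)) := by
  have hpi := Real.pi_pos
  have h : Tendsto (fun t => ∫ u : ℝ,
      (Ioc (-(Real.pi / t)) (Real.pi / t)).indicator (charIntegrand ℓ s t) u) (𝓝[>] 0)
      (𝓝 (∫ u : ℝ, (((2 * Real.cosh (Real.pi * u)) ^ ℓ)⁻¹ : ℝ))) := by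
    -- The growing interval is encoded by an indicator, so that all integrals are over the whole
    -- line; each fixed `u` eventually lies inside.
    refine tendsto_integral_filter_of_dominated_convergence
      (fun u => Real.exp (-(Real.pi / 2 * |u|))) ?_ ?_
      (integrable_exp_neg_mul_abs (half_pos hpi)) (.of_forall fun u => ?_)
    · filter_upwards [self_mem_nhdsWithin] with t ht
      exact (continuous_charIntegrand ℓ s ht).aestronglyMeasurable.indicator measurableSet_Ioc
    · filter_upwards [self_mem_nhdsWithin] with t ht
      refine .of_forall fun u => ?_
      rw [norm_indicator_eq_indicator_norm]
      refine indicator_apply_le' (fun hu => ?_) (fun _ => (Real.exp_pos _).le)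
      refine norm_charIntegrand_le hℓ s ht ?_
      rw [mul_comm, ← le_div_iff₀ ht]
      exact abs_le.mpr ⟨hu.1.le, hu.2⟩
    · refine (tendsto_charIntegrand ℓ s u).congr' ?_
      have ht : ∀ᶠ t : ℝ in 𝓝[>] 0, t * |u| < Real.pi := by
        have h0 : Tendsto (fun t : ℝ => t * |u|) (𝓝[>] 0) (𝓝 (0 * |u|)) :=
          Tendsto.mul_const _ nhdsWithin_le_nhds
        rw [zero_mul] at h0
        exact h0.eventually_lt_const hpi
      filter_upwards [ht, self_mem_nhdsWithin] with t h1 h2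
      rw [mul_comm, ← lt_div_iff₀ h2, abs_lt] at h1
      exact (indicator_of_mem (show u ∈ Ioc (-(Real.pi / t)) (Real.pi / t) from
        ⟨h1.1, h1.2.le⟩) _).symm
  rw [integral_complex_ofReal, integral_inv_two_mul_cosh_pow hℓ] at h
  refine h.congr' ?_
  filter_upwards [self_mem_nhdsWithin] with t ht
  have : 0 < Real.pi / t := div_pos hpi ht
  rw [integral_indicator measurableSet_Ioc, intervalIntegral.integral_of_le (by linarith)]

theorem charGen_mul_zpow_eq {t : ℝ} (ht : 0 < t) (ℓ s : ℕ) (u : ℝ) {q ζ : ℂ}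
    (hq : q = (Real.exp (-t) : ℝ))
    (hζ : ζ = (Real.exp (-t / 2) : ℝ) * exp ((t * u : ℝ) * I)) :
    charGen ℓ q ζ * ζ ^ (-(s : ℤ)) = qPochInf q q ^ (ℓ + 1) *
      ((((t / (2 * Real.pi)) ^ (-(1 / 2 : ℝ)) * Real.exp (-(Real.pi ^ 2 / (2 * t)))) ^ ℓ)⁻¹ *
        Real.exp (s * t / 2) : ℝ) * charIntegrand ℓ s t u := by
  have hq1 : ‖q‖ < 1 := by
    rw [hq, norm_real, Real.norm_of_nonneg (Real.exp_pos _).le]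
    exact Real.exp_lt_one_iff.mpr (by linarith)
  have hQ := qPochInf_ne_zero hq1 hq1
  have hT := triple_product_eq_thetaDual ht u hq hζ
  have h1 : charGen ℓ q ζ = qPochInf q q ^ (ℓ + 1) *
      ((qPochInf ζ q * qPochInf (ζ⁻¹ * q) q * qPochInf q q) ^ ℓ)⁻¹ := by
    rw [charGen, mul_pow, mul_pow, pow_succ', div_eq_mul_inv, mul_inv _ (qPochInf q q ^ ℓ)]
    field_simp
  have h2 : ζ ^ (-(s : ℤ)) = (Real.exp (s * t / 2) : ℝ) * exp ((-(s * (t * u)) : ℝ) * I) := by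
    rw [hζ, ofReal_exp, ofReal_exp, ← exp_add, ← exp_add, ← exp_int_mul]
    congr 1
    push_cast
    ring
  rw [h1, hT, h2, charIntegrand, sub_eq_add_neg, Real.exp_add, Real.exp_neg (t * u ^ 2 / 2)]
  push_cast
  simp only [mul_pow, mul_inv, inv_pow, inv_inv]
  ring

/-- The modular factor in the asymptotic expansion of `charF`. -/
noncomputable def charMain (ℓ : ℕ) (t : ℝ) : ℝ :=
  (t / (2 * Real.pi)) ^ (1 - (ℓ : ℝ) ^ 2 / 2) *
    Real.exp (-(Real.pi ^ 2 * ((ℓ : ℝ) ^ 2 - 2 * (ℓ : ℝ)) / (6 * t)))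

/-- The exponents collect as `-(ℓ²+ℓ)/2 + 1 + ℓ/2 = 1 - ℓ²/2` for `t/2π`, and as `(ℓ²+ℓ) - 3ℓ = ℓ² -
2ℓ` in units of `-π²/(6t)`. -/
theorem charMain_eq {t : ℝ} (ht : 0 < t) (ℓ : ℕ) :
    (((t / (2 * Real.pi)) ^ (-(1 / 2 : ℝ)) * Real.exp (-(Real.pi ^ 2 / (6 * t)))) ^ (ℓ ^ 2 + ℓ)) *
      (t / (2 * Real.pi)) *
      (((t / (2 * Real.pi)) ^ (-(1 / 2 : ℝ)) * Real.exp (-(Real.pi ^ 2 / (2 * t)))) ^ ℓ)⁻¹ =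
    charMain ℓ t := by
  have hy : 0 < t / (2 * Real.pi) := by have := Real.pi_pos; positivity
  rw [charMain, mul_pow, mul_pow, ← Real.rpow_mul_natCast hy.le, ← Real.rpow_mul_natCast hy.le,
    mul_inv, ← Real.rpow_neg hy.le, ← Real.exp_nat_mul, ← Real.exp_nat_mul, ← Real.exp_neg]
  have e1 : (t / (2 * Real.pi)) ^ (1 - (ℓ : ℝ) ^ 2 / 2) =
      (t / (2 * Real.pi)) ^ (-(1 / 2 : ℝ) * (ℓ ^ 2 + ℓ : ℕ)) * (t / (2 * Real.pi)) *
        (t / (2 * Real.pi)) ^ (-(-(1 / 2 : ℝ) * ℓ)) := by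
    conv_rhs => rw [← Real.rpow_add_one hy.ne', ← Real.rpow_add hy]
    congr 1
    push_cast
    ring
  have e2 : Real.exp (-(Real.pi ^ 2 * ((ℓ : ℝ) ^ 2 - 2 * (ℓ : ℝ)) / (6 * t))) =
      Real.exp ((ℓ ^ 2 + ℓ : ℕ) * -(Real.pi ^ 2 / (6 * t))) *
        Real.exp (-(ℓ * -(Real.pi ^ 2 / (2 * t)))) := by
    rw [← Real.exp_add]
    congr 1
    push_cast
    field_simp
    ring
  rw [e1, e2]
  ring

/-- The factor of `charF` that converges to `charConst`. -/
noncomputable def charCorrection (ℓ s : ℕ) (t : ℝ) : ℂ :=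
  (Real.exp (t / 24) ^ (ℓ ^ 2 + ℓ) * Real.exp (s * t / 2) : ℝ) *
    qPochInf (Real.exp (-(4 * Real.pi ^ 2 / t)) : ℝ) (Real.exp (-(4 * Real.pi ^ 2 / t)) : ℝ) ^
      (ℓ ^ 2 + ℓ) *
    ∫ u in (-(Real.pi / t))..(Real.pi / t), charIntegrand ℓ s t u

theorem tendsto_charCorrection {ℓ : ℕ} (hℓ : ℓ ≠ 0) (s : ℕ) :
    Tendsto (charCorrection ℓ s) (𝓝[>] 0) (𝓝 (charConst ℓ : ℂ)) := by
  have hpi := Real.pi_pos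
  have h1 : Tendsto (fun t : ℝ => ((Real.exp (t / 24) ^ (ℓ ^ 2 + ℓ) * Real.exp (s * t / 2) : ℝ) : ℂ))
      (𝓝[>] 0) (𝓝 1) := by
    have : Continuous fun t : ℝ =>
      ((Real.exp (t / 24) ^ (ℓ ^ 2 + ℓ) * Real.exp (s * t / 2) : ℝ) : ℂ) := by fun_prop
    simpa using (this.tendsto 0).mono_left nhdsWithin_le_nhds
  have h2 : Tendsto (fun t : ℝ => ((Real.exp (-(4 * Real.pi ^ 2 / t)) : ℝ) : ℂ)) (𝓝[>] 0)
      (𝓝 0) := by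
    have h : Tendsto (fun t : ℝ => 4 * Real.pi ^ 2 / t) (𝓝[>] 0) atTop := by
      simpa only [div_eq_mul_inv] using
        tendsto_inv_nhdsGT_zero.const_mul_atTop (by positivity : 0 < 4 * Real.pi ^ 2)
    have h' : Tendsto (fun t : ℝ => Real.exp (-(4 * Real.pi ^ 2 / t))) (𝓝[>] 0) (𝓝 0) :=
      Real.tendsto_exp_atBot.comp (tendsto_neg_atTop_atBot.comp h)
    exact ofReal_zero ▸ (continuous_ofReal.tendsto 0).comp h'
  have h3 := (tendsto_qPochInf_self_nhds_zero.comp h2).pow (ℓ ^ 2 + ℓ)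
  have h4 := (h1.mul h3).mul (tendsto_integral_charIntegrand hℓ s)
  rw [one_pow, one_mul, one_mul] at h4
  exact h4

theorem charF_eq {t : ℝ} (ht : 0 < t) {ℓ : ℕ} (hℓ : ℓ ≠ 0) (s : ℕ) :
    charF ℓ s (Real.exp (-t) : ℝ) = charMain ℓ t * charCorrection ℓ s t := by
  have hpi := Real.pi_pos
  have hqn : ‖((Real.exp (-t) : ℝ) : ℂ)‖ = Real.exp (-t) := by
    rw [norm_real, Real.norm_of_nonneg (Real.exp_pos _).le]
  have hq1 : ‖((Real.exp (-t) : ℝ) : ℂ)‖ < 1 := by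
    rw [hqn]
    exact Real.exp_lt_one_iff.mpr (by linarith)
  have hint : ∫ θ in (-Real.pi)..Real.pi, charGen ℓ (Real.exp (-t) : ℝ)
      ((Real.exp (-t / 2) : ℝ) * exp (θ * I)) *
        ((Real.exp (-t / 2) : ℝ) * exp (θ * I)) ^ (-(s : ℤ)) =
      t * (qPochInf (Real.exp (-t) : ℝ) (Real.exp (-t) : ℝ) ^ (ℓ + 1) *
      ((((t / (2 * Real.pi)) ^ (-(1 / 2 : ℝ)) * Real.exp (-(Real.pi ^ 2 / (2 * t)))) ^ ℓ)⁻¹ *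
        Real.exp (s * t / 2) : ℝ) *
      ∫ u in (-(Real.pi / t))..(Real.pi / t), charIntegrand ℓ s t u) := by
    -- The substitution `θ = tu` stretches `[-π, π]` to `[-π/t, π/t]`, the scale on which the
    -- integrand has a limit.
    have hsub := intervalIntegral.smul_integral_comp_mul_left (a := -(Real.pi / t))
      (b := Real.pi / t) (fun θ : ℝ => charGen ℓ (Real.exp (-t) : ℝ)
      ((Real.exp (-t / 2) : ℝ) * exp (θ * I)) *
        ((Real.exp (-t / 2) : ℝ) * exp (θ * I)) ^ (-(s : ℤ))) t
    rw [mul_neg, mul_div_cancel₀ _ ht.ne'] at hsub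
    rw [← hsub, real_smul]
    congr 1
    rw [← intervalIntegral.integral_const_mul]
    refine intervalIntegral.integral_congr fun u _ => ?_
    exact charGen_mul_zpow_eq ht ℓ s u rfl rfl
  rw [charF, laurentCoeff_charGen ℓ hq1 (Real.exp_pos (-t / 2))
    (by rw [hqn]; exact Real.exp_lt_exp.mpr (by linarith)) (Real.exp_lt_one_iff.mpr (by linarith)), hint,
    ← charMain_eq ht, charCorrection]
  have hpow : ℓ ^ 2 - 1 + (ℓ + 1) = ℓ ^ 2 + ℓ := by
    have : 1 ≤ ℓ ^ 2 := Nat.one_le_pow _ _ (Nat.pos_of_ne_zero hℓ)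
    omega
  have hQ : qPochInf (Real.exp (-t) : ℝ) (Real.exp (-t) : ℝ) ^ (ℓ ^ 2 - 1) *
      qPochInf (Real.exp (-t) : ℝ) (Real.exp (-t) : ℝ) ^ (ℓ + 1) =
      qPochInf (Real.exp (-t) : ℝ) (Real.exp (-t) : ℝ) ^ (ℓ ^ 2 + ℓ) := by
    rw [← pow_add, hpow]
  have hQ' := hQ.trans (congrArg (· ^ (ℓ ^ 2 + ℓ)) (qPochInf_exp_neg ht))
  have hpic : (Real.pi : ℂ) ≠ 0 := by exact_mod_cast hpi.ne'
  -- With the powers of `(q)_∞` and the integral treated as opaque symbols, the claim is a multiple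
  -- of `hQ'`.
  generalize qPochInf (Real.exp (-t) : ℝ) (Real.exp (-t) : ℝ) ^ (ℓ ^ 2 - 1) = A at hQ'
  generalize qPochInf (Real.exp (-t) : ℝ) (Real.exp (-t) : ℝ) ^ (ℓ + 1) = B at hQ'
  generalize (∫ u in (-(Real.pi / t))..(Real.pi / t), charIntegrand ℓ s t u) = J
  generalize qPochInf (Real.exp (-(4 * Real.pi ^ 2 / t)) : ℝ)
    (Real.exp (-(4 * Real.pi ^ 2 / t)) : ℝ) = E at hQ'
  simp only [ofReal_mul, ofReal_pow, ofReal_inv, ofReal_div, ofReal_ofNat, mul_pow] at hQ' ⊢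
  rw [mul_inv (2 : ℂ), div_eq_mul_inv (t : ℂ), mul_inv (2 : ℂ)]
  linear_combination (2 : ℂ)⁻¹ * (Real.pi : ℂ)⁻¹ * t *
    (((((t / (2 * Real.pi)) ^ (-(1 / 2 : ℝ)) : ℝ) : ℂ) ^ ℓ *
      ((Real.exp (-(Real.pi ^ 2 / (2 * t))) : ℝ) : ℂ) ^ ℓ)⁻¹ *
      ((Real.exp (s * t / 2) : ℝ) : ℂ)) * J * hQ'

theorem charConst_ne_zero (ℓ : ℕ) : charConst ℓ ≠ 0 := by
  have : 0 < Real.Gamma (((ℓ : ℝ) + 1) / 2) := Real.Gamma_pos_of_pos (by positivity)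
  have : 0 < charConst ℓ := by
    rw [charConst]
    positivity
  exact this.ne'

end Asymptotic

theorem theorem1p1 (ℓ : ℕ) (hℓ : 3 ≤ ℓ) :
    (∀ q : ℂ, 0 < ‖q‖ → ‖q‖ < 1 →
      ∃! a : ℤ → ℂ, IsLaurentExpansionOn (charGen ℓ q) a ‖q‖ 1) ∧
    ∀ s : ℕ,
      (fun t : ℝ => charF ℓ s ((Real.exp (-t) : ℝ) : ℂ)) ~[𝓝[>] (0 : ℝ)]
        (fun t : ℝ =>
          ((charConst ℓ * (t / (2 * Real.pi)) ^ (1 - (ℓ : ℝ) ^ 2 / 2) *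
            Real.exp (-(Real.pi ^ 2 * ((ℓ : ℝ) ^ 2 - 2 * (ℓ : ℝ)) / (6 * t))) : ℝ) : ℂ)) := by
  have hℓ0 : ℓ ≠ 0 := by omega
  refine ⟨fun q _ hq => existsUnique_isLaurentExpansionOn_charGen ℓ hq, fun s => ?_⟩
  have hC : (charConst ℓ : ℂ) ≠ 0 := by exact_mod_cast charConst_ne_zero ℓ
  -- Because the limit `charConst ℓ` is nonzero, convergence of the correction factor is the same as
  -- asymptotic equivalence, and it multiplies with the exact factor `charMain`.
  have h := (IsEquivalent.refl (u := fun t : ℝ => (charMain ℓ t : ℂ)) (l := 𝓝[>] 0)).mul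
    ((isEquivalent_const_iff_tendsto hC).mpr (tendsto_charCorrection hℓ0 s))
  refine (h.congr_left ?_).congr_right (.of_forall fun t => ?_)
  · filter_upwards [self_mem_nhdsWithin] with t ht
    exact (charF_eq ht hℓ0 s).symm
  · simp only [Pi.mul_apply, charMain, Function.const_apply]
    push_cast
    ring
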